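/- Let $\mathsf{Mon}$ be the category of monads on $\mathsf{Set}$. For a monad $R$, a (left) $R$-module is a functor $M:\mathsf{Set}\to\mathsf{Set}$ with a natural transformation $\rho^M: M\cdot R\to M$ such that $\rho^M\circ\rho^M R=\rho^M\circ M\mu$ and $\rho^M\circ M\eta=1_M$; a morphism $\tau:M\to N$ of $R$-modules is a natural transformation with $\tau\circ\rho^M=\rho^N\circ\tau R$. For a monad morphism $f:R\to S$ and an $S$-module $N$, let $f^*N$ be the functor $N$ with substitution $N\cdot R\xrightarrow{Nf}N\cdot S\xrightarrow{\rho^N}N$. Let $\int\mathsf{Mod}$ be the category of pairs $(R,M)$ of a monad $R$ and an $R$-module $M$, a morphism $(R,M)\to(S,N)$ being a pair of a monad morphism $f:R\to S$ and a morphism of $R$-modules $M\to f^*N$. A *signature* is a section $\Sigma$ of the forgetful functor $\int\mathsf{Mod}\to\mathsf{Mon}$, and a morphism of signatures is a natural transformation that lies over the identity of $\mathsf{Mon}$. For an $R$-module $M$, the *derivative* $M'$ is the functor $X\mapsto M(X+*)$ with substitution $M(R(X)+*)\to M(R(X+*))\xrightarrow{\rho^M}M(X+*)$, whose first arrow is $M$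 applied to the map given by $R$ of the inclusion $X\to X+*$ and by the unit of $R$ at the added point; $M^{(k)}$ is the $k$-th iterated derivative. For a finite, possibly empty, list $s=(s_1,\dots,s_n)$ of nonnegative integers, the *elementary signature* $\Theta^{(s)}$ is $R\mapsto R^{(s_1)}\times\cdots\times R^{(s_n)}$, where $R$ is regarded as a module over itself. An *algebraic signature* is a (possibly infinite) set-indexed coproduct of elementary signatures in the category of signatures. A *model* of a signature $\Sigma$ is a monad $R$ with a morphism of $R$-modules $r:\Sigma(R)\to R$; a morphism of models $(R,r)\to(S,s)$ is a monad morphism $m:R\to S$ with $m\circ r=s\circ\Sigma(m)$. A signature is *representable* if its category of models has an initial object. **Statement.** Let $J$ be a small category and $F$ a functor from $J$ to the category of signatures such that $F(j)$ is an algebraic signature for every object $j$ of $J$. Then every colimit of $F$ in the category of signatures is representable. -/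

import Mathlib

open CategoryTheory CategoryTheory.Limits

universe u

/-- Monads on the category of sets, with monad morphisms: the category `Mon`. -/
abbrev SetMonad : Type (u + 1) := CategoryTheory.Monad (Type u)

/-! ### Modules over a monad -/

/-- A (left) module over a monad `R`: a functor `M : Set ⥤ Set` with a natural transformation
`M · R ⟶ M` (module substitution) compatible with the multiplication and the unit of `R`. -/
structure MonadModule (R : SetMonad.{u}) where
  functor : Type u ⥤ Type u
  act : R.toFunctor ⋙ functor ⟶ functor
  act_act : ∀ X : Type u,
    act.app (R.obj X) ≫ act.app X = functor.map (R.μ.app X) ≫ act.app X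
  act_unit : ∀ X : Type u, functor.map (R.η.app X) ≫ act.app X = 𝟙 (functor.obj X)

namespace MonadModule

/-- Linear natural transformations between modules over the same monad. -/
@[ext]
structure Hom {R : SetMonad.{u}} (M N : MonadModule R) where
  nat : M.functor ⟶ N.functor
  linear : ∀ X : Type u, M.act.app X ≫ nat.app X = nat.app (R.obj X) ≫ N.act.app X

/-- The category `Mod(R)`. -/
instance category (R : SetMonad.{u}) : Category (MonadModule R) where
  Hom M N := Hom M N
  id M := { nat := 𝟙 M.functor, linear := fun X => by simp }
  comp f g :=
    { nat := f.nat ≫ g.nat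
      linear := fun X => by
        have hf := f.linear X
        have hg := g.linear X
        simp only [NatTrans.comp_app, Category.assoc]
        rw [← hg, ← Category.assoc, hf, Category.assoc] }

@[ext]
theorem hom_ext {R : SetMonad.{u}} {M N : MonadModule R} (f g : M ⟶ N) (h : f.nat = g.nat) :
    f = g :=
  Hom.ext h

@[simp]
theorem id_nat {R : SetMonad.{u}} (M : MonadModule R) : Hom.nat (𝟙 M) = 𝟙 M.functor := rfl

@[simp]
theorem comp_nat {R : SetMonad.{u}} {M N P : MonadModule R} (f : M ⟶ N) (g : N ⟶ P) :
    Hom.nat (f ≫ g) = f.nat ≫ g.nat := rfl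

/-- Every monad is a module over itself. -/
@[simps]
abbrev tautological (R : SetMonad.{u}) : MonadModule R where
  functor := R.toFunctor
  act := R.μ
  act_act X := (R.assoc X).symm
  act_unit X := R.right_unit X

/-- The pullback `f^* : Mod(S) ⥤ Mod(R)` along a morphism of monads `f : R ⟶ S`: the underlying
functor is kept, and the substitution becomes `M · R ⟶ M · S ⟶ M`. -/
@[simps]
def pullback {R S : SetMonad.{u}} (f : R ⟶ S) : MonadModule S ⥤ MonadModule R where
  obj M :=
    { functor := M.functor
      act :=
        { app := fun X => M.functor.map (f.app X) ≫ M.act.app X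
          naturality := fun X Y g => by
            have h := M.act.naturality g
            have hf := f.naturality g
            simp only [Functor.comp_map] at h ⊢
            rw [← Category.assoc, ← M.functor.map_comp, hf, M.functor.map_comp, Category.assoc, h,
              Category.assoc] }
      act_act := fun X => by
        have h1 := M.act_act X
        have h2 := M.act.naturality (f.app X)
        have h3 := f.app_μ X
        simp only [Functor.comp_map] at h2
        simp only [Category.assoc]
        rw [← Category.assoc (M.act.app _), ← h2, Category.assoc, h1, ← Category.assoc (M.functor.map (R.μ.app X)),
          ← M.functor.map_comp, h3]
        simp only [Functor.map_comp, ← Category.assoc]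
        congr 2
        rw [← Functor.map_comp, ← Functor.map_comp, f.naturality]
      act_unit := fun X => by
        have h := M.act_unit X
        rw [← Category.assoc, ← M.functor.map_comp, f.app_η, h] }
  map {M N} m :=
    { nat := m.nat
      linear := fun X => by
        have h := m.linear X
        have h' := m.nat.naturality (f.app X)
        dsimp only
        rw [Category.assoc, h, ← Category.assoc, h', Category.assoc] }

/-- The product of a family of modules over the same monad, computed pointwise; the product of the
empty family is the final module. -/
@[simps]
def pi {R : SetMonad.{u}} {n : ℕ} (M : Fin n → MonadModule R) : MonadModule R where
  functor :=
    { obj := fun X => ∀ i, (M i).functor.obj X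
      map := fun f => ↾fun x i => (M i).functor.map f (x i) }
  act :=
    { app := fun X => ↾fun x i => (M i).act.app X (x i)
      naturality := fun X Y f => by
        ext x i
        exact ConcreteCategory.congr_hom ((M i).act.naturality f) (x i) }
  act_act X := by
    ext x i
    exact ConcreteCategory.congr_hom ((M i).act_act X) (x i)
  act_unit X := by
    ext x i
    exact ConcreteCategory.congr_hom ((M i).act_unit X) (x i)

end MonadModule

/-! ### The total category of modules -/

/-- Objects of the total module category `∫Mod`: pairs of a monad and a module over it. -/
structure TotalModule where
  base : SetMonad.{u}
  fiber : MonadModule base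

namespace TotalModule

/-- A morphism `(R, M) ⟶ (S, N)` of `∫Mod`: a monad morphism `f : R ⟶ S` and a module morphism
`M ⟶ f^* N`. -/
structure Hom (A B : TotalModule.{u}) where
  base : A.base ⟶ B.base
  fiber : A.fiber ⟶ (MonadModule.pullback base).obj B.fiber

theorem Hom.ext' {A B : TotalModule.{u}} {f g : Hom A B} (h : f.base = g.base)
    (h' : (f.fiber.nat : A.fiber.functor ⟶ B.fiber.functor) = g.fiber.nat) : f = g := by
  obtain ⟨f, m⟩ := f
  obtain ⟨g, n⟩ := g
  obtain rfl : f = g := h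
  obtain rfl : m = n := MonadModule.hom_ext _ _ h'
  rfl

instance category : Category TotalModule.{u} where
  Hom := Hom
  id A :=
    { base := 𝟙 A.base
      fiber :=
        { nat := 𝟙 A.fiber.functor
          linear := fun X => by
            have h : A.fiber.act.app X = A.fiber.functor.map (𝟙 _) ≫ A.fiber.act.app X := by simp
            exact (Category.comp_id _).trans (h.trans (Category.id_comp _).symm) } }
  comp {A B C} f g :=
    { base := f.base ≫ g.base
      fiber :=
        { nat := (f.fiber.nat : A.fiber.functor ⟶ B.fiber.functor) ≫ g.fiber.nat
          linear := fun X => by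
            have h : C.fiber.functor.map (f.base.app X) ≫ C.fiber.functor.map (g.base.app X) ≫
                C.fiber.act.app X =
                C.fiber.functor.map (f.base.app X ≫ g.base.app X) ≫ C.fiber.act.app X := by simp
            exact ((f.fiber ≫ (MonadModule.pullback f.base).map g.fiber).linear X).trans
              (congrArg (fun t => _ ≫ t) h) } }
  id_comp f := Hom.ext' (Category.id_comp _) (Category.id_comp _)
  comp_id f := Hom.ext' (Category.comp_id _) (Category.comp_id _)
  assoc f g h := Hom.ext' (Category.assoc _ _ _) (Category.assoc _ _ _)

/-- The forgetful functor `∫Mod ⥤ Mon`. -/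
def forget : TotalModule.{u} ⥤ SetMonad.{u} where
  obj A := A.base
  map f := f.base

end TotalModule

/-! ### Signatures -/

/-- A signature: a section of the forgetful functor `∫Mod ⥤ Mon`. It sends a monad `R` to an
`R`-module `Σ(R)` and a monad morphism `f : R ⟶ S` to a morphism of `R`-modules
`Σ(R) ⟶ f^* Σ(S)`, functorially; see `Signature.toFunctor` and `Signature.toFunctor_forget`. -/
structure Signature where
  obj (R : SetMonad.{u}) : MonadModule R
  map {R S : SetMonad.{u}} (f : R ⟶ S) : obj R ⟶ (MonadModule.pullback f).obj (obj S)
  map_id (R : SetMonad.{u}) : (map (𝟙 R)).nat = 𝟙 (obj R).functor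
  map_comp {R S T : SetMonad.{u}} (f : R ⟶ S) (g : S ⟶ T) :
    (map (f ≫ g)).nat =
      ((map f).nat : (obj R).functor ⟶ (obj S).functor) ≫ (map g).nat

namespace Signature

/-- A signature as a functor `Mon ⥤ ∫Mod`. -/
def toFunctor (A : Signature.{u}) : SetMonad.{u} ⥤ TotalModule.{u} where
  obj R := ⟨R, A.obj R⟩
  map f := ⟨f, A.map f⟩
  map_id R := TotalModule.Hom.ext' rfl (A.map_id R)
  map_comp f g := TotalModule.Hom.ext' rfl (A.map_comp f g)

theorem toFunctor_forget (A : Signature.{u}) : A.toFunctor ⋙ TotalModule.forget = 𝟭 _ := rfl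

/-- A morphism of signatures: module morphisms `A(R) ⟶ B(R)`, natural in the monad `R`, that is,
a natural transformation between functors `Mon ⥤ ∫Mod` lying over the identity of `Mon`. -/
@[ext]
structure Hom (A B : Signature.{u}) where
  app (R : SetMonad.{u}) : A.obj R ⟶ B.obj R
  naturality {R S : SetMonad.{u}} (f : R ⟶ S) :
    A.map f ≫ (MonadModule.pullback f).map (app S) = app R ≫ B.map f

/-- The category `Sig` of signatures. -/
instance category : Category Signature.{u} where
  Hom := Hom
  id A :=
    { app := fun R => 𝟙 (A.obj R)
      naturality := fun f => by
        rw [CategoryTheory.Functor.map_id, Category.comp_id, Category.id_comp] }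
  comp m n :=
    { app := fun R => m.app R ≫ n.app R
      naturality := fun f => by
        rw [Functor.map_comp, ← Category.assoc, m.naturality, Category.assoc, n.naturality,
          Category.assoc] }

@[ext]
theorem hom_ext {A B : Signature.{u}} (m n : A ⟶ B) (h : ∀ R, m.app R = n.app R) : m = n :=
  Hom.ext (funext h)

@[simp]
theorem id_app (A : Signature.{u}) (R : SetMonad.{u}) : Hom.app (𝟙 A) R = 𝟙 (A.obj R) := rfl

@[simp]
theorem comp_app {A B C : Signature.{u}} (m : A ⟶ B) (n : B ⟶ C) (R : SetMonad.{u}) :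
    Hom.app (m ≫ n) R = m.app R ≫ n.app R := rfl

/-- The signature `Θ : R ↦ R`. -/
def theta : Signature.{u} where
  obj R := MonadModule.tautological R
  map {R S} f :=
    { nat := f.toNatTrans
      linear := fun X => by
        have h : R.μ.app X ≫ f.app X = f.app (R.obj X) ≫ S.map (f.app X) ≫ S.μ.app X := by
          rw [f.app_μ, f.naturality, Category.assoc]
        exact h }
  map_id _ := rfl
  map_comp _ _ := rfl

end Signature

/-! ### Derivation -/

/-- The functor `X ↦ X + *`. -/
@[simps]
def addPoint : Type u ⥤ Type u where
  obj X := Option X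
  map f := ↾Option.map f
  map_id X := by ext x; cases x <;> rfl
  map_comp f g := by ext x; cases x <;> rfl

/-- The inclusion `X ⟶ X + *`. -/
def addPointIncl (X : Type u) : X ⟶ addPoint.obj X := ↾(some : X → Option X)

theorem addPointIncl_naturality {X Y : Type u} (f : X ⟶ Y) :
    addPointIncl X ≫ addPoint.map f = f ≫ addPointIncl Y := rfl

/-- The map `R(X) + * ⟶ R(X + *)` given by `R` of the inclusion `X ⟶ X + *` and by the unit at the
added point. -/
def addPointDist (R : SetMonad.{u}) (X : Type u) :
    addPoint.obj (R.obj X) ⟶ R.obj (addPoint.obj X) :=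
  ↾fun t : Option (R.obj X) =>
    t.elim (R.η.app (addPoint.obj X) (none : Option X)) (R.map (addPointIncl X))

theorem addPointIncl_dist (R : SetMonad.{u}) (X : Type u) :
    addPointIncl (R.obj X) ≫ addPointDist R X = R.map (addPointIncl X) := rfl

theorem addPoint_hom_ext {X Y : Type u} {f g : addPoint.obj X ⟶ Y}
    (h : addPointIncl X ≫ f = addPointIncl X ≫ g)
    (h' : f (none : Option X) = g (none : Option X)) : f = g := by
  ext t
  cases (t : Option X) with
  | none => exact h'
  | some a => exact ConcreteCategory.congr_hom h a

theorem addPointDist_naturality (R : SetMonad.{u}) {X Y : Type u} (f : X ⟶ Y) :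
    addPoint.map (R.map f) ≫ addPointDist R Y = addPointDist R X ≫ R.map (addPoint.map f) := by
  apply addPoint_hom_ext
  · rw [← Category.assoc, addPointIncl_naturality, Category.assoc, addPointIncl_dist,
      ← Category.assoc, addPointIncl_dist, ← R.map_comp, ← R.map_comp, addPointIncl_naturality]
  · exact ConcreteCategory.congr_hom (R.η.naturality (addPoint.map f)) (none : Option X)

theorem addPointDist_unit (R : SetMonad.{u}) (X : Type u) :
    addPoint.map (R.η.app X) ≫ addPointDist R X = R.η.app (addPoint.obj X) := by
  apply addPoint_hom_ext
  · exact (R.η.naturality (addPointIncl X)).symm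
  · rfl

theorem addPointDist_hom {R S : SetMonad.{u}} (f : R ⟶ S) (X : Type u) :
    addPoint.map (f.app X) ≫ addPointDist S X = addPointDist R X ≫ f.app (addPoint.obj X) := by
  apply addPoint_hom_ext
  · rw [← Category.assoc, addPointIncl_naturality, Category.assoc, addPointIncl_dist,
      ← Category.assoc, addPointIncl_dist, f.naturality]
  · exact (ConcreteCategory.congr_hom (f.app_η (addPoint.obj X)) (none : Option X)).symm

theorem addPointDist_mul (R : SetMonad.{u}) (X : Type u) :
    addPoint.map (R.μ.app X) ≫ addPointDist R X =
      addPointDist R (R.obj X) ≫ R.map (addPointDist R X) ≫ R.μ.app (addPoint.obj X) := by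
  apply addPoint_hom_ext
  · have h : R.μ.app X ≫ R.map (addPointIncl X) =
        R.map (addPointIncl (R.obj X)) ≫ R.map (addPointDist R X) ≫
          R.μ.app (addPoint.obj X) := by
      rw [← R.mu_naturality, ← Category.assoc, ← R.map_comp, addPointIncl_dist]
    exact h
  · have h : R.η.app (addPoint.obj (R.obj X)) ≫ R.map (addPointDist R X) ≫
        R.μ.app (addPoint.obj X) = addPointDist R X := by
      rw [← Category.assoc, ← R.unit_naturality, Category.assoc, R.left_unit]
      rfl
    exact (ConcreteCategory.congr_hom h (none : Option (R.obj X))).symm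

/-- The derivative `M'` of a module: `M'(X) = M(X + *)`, with substitution
`M(R(X) + *) ⟶ M(R(X + *)) ⟶ M(X + *)`. -/
def MonadModule.deriv {R : SetMonad.{u}} (M : MonadModule R) : MonadModule R where
  functor := addPoint ⋙ M.functor
  act :=
    { app := fun X => M.functor.map (addPointDist R X) ≫ M.act.app (addPoint.obj X)
      naturality := fun X Y f => by
        have h : M.functor.map (R.map (addPoint.map f)) ≫ M.act.app _ =
          M.act.app _ ≫ M.functor.map (addPoint.map f) := M.act.naturality (addPoint.map f)
        dsimp only [Functor.comp_map, Functor.comp_obj]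
        rw [← Category.assoc, ← M.functor.map_comp, addPointDist_naturality, M.functor.map_comp,
          Category.assoc, h, Category.assoc] }
  act_act X := by
    have h : M.functor.map (R.map (addPointDist R X)) ≫ M.act.app _ =
      M.act.app _ ≫ M.functor.map (addPointDist R X) := M.act.naturality (addPointDist R X)
    dsimp only [Functor.comp_map, Functor.comp_obj]
    rw [← Category.assoc (M.functor.map (addPoint.map _)), ← M.functor.map_comp, addPointDist_mul,
      Category.assoc, ← Category.assoc (M.act.app _) (M.functor.map _), ← h, Category.assoc,
      M.act_act]
    simp only [Functor.map_comp, Category.assoc]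
  act_unit X := by
    dsimp only [Functor.comp_map, Functor.comp_obj]
    rw [← Category.assoc, ← M.functor.map_comp, addPointDist_unit, M.act_unit]

namespace Signature

/-- The derivative of a signature, `R ↦ Σ(R)'`. -/
def deriv (A : Signature.{u}) : Signature.{u} where
  obj R := (A.obj R).deriv
  map {R S} f :=
    { nat := Functor.whiskerLeft addPoint (A.map f).nat
      linear := fun X => by
        have h := (A.map f).linear (addPoint.obj X)
        have h' := (A.map f).nat.naturality (addPointDist R X)
        dsimp only [MonadModule.deriv, MonadModule.pullback, Functor.whiskerLeft_app,
          Functor.comp_obj, Functor.comp_map] at h h' ⊢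
        rw [Category.assoc, h, ← Category.assoc, h', Category.assoc,
          ← Category.assoc ((A.obj S).functor.map _), ← Category.assoc ((A.obj S).functor.map _),
          ← Functor.map_comp, ← Functor.map_comp, addPointDist_hom] }
  map_id R := congrArg (Functor.whiskerLeft addPoint) (A.map_id R)
  map_comp f g := congrArg (Functor.whiskerLeft addPoint) (A.map_comp f g)

/-- The iterated derivative `R ↦ Σ(R)^(k)`. -/
def iterDeriv (A : Signature.{u}) : ℕ → Signature.{u}
  | 0 => A
  | k + 1 => (A.iterDeriv k).deriv

/-- The product of a finite family of signatures, `R ↦ ∏ i, Σᵢ(R)`. -/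
def pi {n : ℕ} (A : Fin n → Signature.{u}) : Signature.{u} where
  obj R := MonadModule.pi fun i => (A i).obj R
  map f :=
    { nat :=
        { app := fun X => ↾fun x i => ((A i).map f).nat.app X (x i)
          naturality := fun X Y g => by
            ext x
            exact funext fun i =>
              ConcreteCategory.congr_hom (((A i).map f).nat.naturality g) (x i) }
      linear := fun X => by
        ext x
        exact funext fun i => ConcreteCategory.congr_hom (((A i).map f).linear X) (x i) }
  map_id R := by
    ext X x
    exact funext fun i =>
      ConcreteCategory.congr_hom (NatTrans.congr_app ((A i).map_id R) X) (x i)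
  map_comp f g := by
    ext X x
    exact funext fun i =>
      ConcreteCategory.congr_hom (NatTrans.congr_app ((A i).map_comp f g) X) (x i)

/-- The elementary signature `R ↦ R^(s₁) × ⋯ × R^(sₙ)`. -/
def elementary (s : List ℕ) : Signature.{u} :=
  pi fun i : Fin s.length => theta.iterDeriv (s.get i)

/-- An algebraic signature is a (possibly infinite) coproduct, in the category of signatures, of
elementary signatures. -/
def IsAlgebraic (A : Signature.{u}) : Prop :=
  ∃ (I : Type u) (s : I → List ℕ) (ι : ∀ i, elementary (s i) ⟶ A),
    Nonempty (IsColimit (Cofan.mk A ι))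

/-! ### Models -/

/-- A model of a signature: a monad `R` with a module morphism `Σ(R) ⟶ R`. -/
structure Model (A : Signature.{u}) where
  monad : SetMonad.{u}
  action : A.obj monad ⟶ MonadModule.tautological monad

namespace Model

/-- A morphism of models: a monad morphism `m : R ⟶ S` such that the square of `R`-modules with
sides `Σ(R) ⟶ R ⟶ m^* S` and `Σ(R) ⟶ m^* Σ(S) ⟶ m^* S` commutes. -/
@[ext]
structure Hom {A : Signature.{u}} (M N : A.Model) where
  hom : M.monad ⟶ N.monad
  comm : M.action ≫ theta.map hom = A.map hom ≫ (MonadModule.pullback hom).map N.action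

/-- The category of models of a signature. -/
instance category (A : Signature.{u}) : Category A.Model where
  Hom M N := Hom M N
  id M :=
    { hom := 𝟙 M.monad
      comm := by
        apply MonadModule.hom_ext
        exact (Category.comp_id _).trans ((Category.id_comp _).symm.trans
          (congrArg (· ≫ M.action.nat) (A.map_id M.monad).symm)) }
  comp {L M N} f g :=
    { hom := f.hom ≫ g.hom
      comm := by
        have hf := congrArg MonadModule.Hom.nat f.comm
        have hg := congrArg MonadModule.Hom.nat g.comm
        apply MonadModule.hom_ext
        ext X : 2
        have hf' := NatTrans.congr_app hf X
        have hg' := NatTrans.congr_app hg X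
        have h := NatTrans.congr_app (A.map_comp f.hom g.hom) X
        change L.action.nat.app X ≫ f.hom.app X = (A.map f.hom).nat.app X ≫ M.action.nat.app X
          at hf'
        change M.action.nat.app X ≫ g.hom.app X = (A.map g.hom).nat.app X ≫ N.action.nat.app X
          at hg'
        change (A.map (f.hom ≫ g.hom)).nat.app X =
          (A.map f.hom).nat.app X ≫ (A.map g.hom).nat.app X at h
        change L.action.nat.app X ≫ f.hom.app X ≫ g.hom.app X =
          (A.map (f.hom ≫ g.hom)).nat.app X ≫ N.action.nat.app X
        calc L.action.nat.app X ≫ f.hom.app X ≫ g.hom.app X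
            = ((A.map f.hom).nat.app X ≫ M.action.nat.app X) ≫ g.hom.app X :=
              (Category.assoc _ _ _).symm.trans (congrArg (· ≫ g.hom.app X) hf')
          _ = (A.map f.hom).nat.app X ≫ (A.map g.hom).nat.app X ≫ N.action.nat.app X :=
              (Category.assoc _ _ _).trans (congrArg ((A.map f.hom).nat.app X ≫ ·) hg')
          _ = (A.map (f.hom ≫ g.hom)).nat.app X ≫ N.action.nat.app X :=
              (Category.assoc _ _ _).symm.trans (congrArg (· ≫ N.action.nat.app X) h.symm) }
  id_comp f := Hom.ext (Category.id_comp f.hom)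
  comp_id f := Hom.ext (Category.comp_id f.hom)
  assoc f g h := Hom.ext (Category.assoc f.hom g.hom h.hom)

end Model

/-- A signature is representable if its category of models has an initial object. -/
def IsRepresentable (A : Signature.{u}) : Prop :=
  HasInitial A.Model

end Signature

/-! The legs of a colimit of signatures are jointly surjective: their joint image is a subsignature
through which the whole cocone factors, so by the universal property it is everything
(`jointlySurjective_of_isColimit`). Used for the coproducts and then for the diagram, this covers a
colimit of algebraic signatures by a small family of elementary signatures.

It remains to see that a signature `B` with such a cover `e` is representable
(`isRepresentable_of_jointlySurjective`). Each `e k` gives an operation with binding in every model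
of `B`. The initial model should consist of terms in these operations, two terms being identified
when they agree in all models. This quotient is realised inside families of elements indexed by all
models `S`: a definable family is one generated by variables and operations. Such families are
closed under substitution (`Definable.bind`) and form a small set, since terms do
(`small_definable`), so they form a monad.

An element of `B` over this monad acts by lifting it to some `e k` and applying the operation; the
value at `S` depends only on the element itself (`op_initialHom`), so the choice of lift is
harmless. Evaluation at `S` is then a morphism of models, and it is the only one because morphisms
of models preserve definable families (`Definable.hom_eq`). -/

/-! ### Substitution in elementwise form -/

/-- The unit of a monad on sets, as a plain function. -/
def SetMonad.unit (R : SetMonad.{u}) {X : Type u} (x : X) : R.obj X :=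
  R.η.app X x

namespace MonadModule

variable {R S : SetMonad.{u}}

/-- Simultaneous substitution of elements of the monad in an element of a module. -/
def subst (M : MonadModule R) {X Y : Type u} (f : X → R.obj Y) (t : M.functor.obj X) :
    M.functor.obj Y :=
  M.act.app Y (M.functor.map (↾f) t)

theorem map_eq_subst (M : MonadModule R) {X Y : Type u} (g : X ⟶ Y) (t : M.functor.obj X) :
    M.functor.map g t = M.subst (fun x => SetMonad.unit R (g x)) t := by
  have h := ConcreteCategory.congr_hom (M.act_unit Y) (M.functor.map g t)
  have h' := ConcreteCategory.congr_hom (M.functor.map_comp g (R.η.app Y)) t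
  exact h.symm.trans (congrArg (M.act.app Y) h'.symm)

theorem act_eq_subst (M : MonadModule R) {X : Type u} (t : M.functor.obj (R.obj X)) :
    M.act.app X t = M.subst (fun x => x) t := by
  have h := ConcreteCategory.congr_hom (M.functor.map_id (R.obj X)) t
  exact congrArg (M.act.app X) h.symm

theorem subst_unit (M : MonadModule R) {X : Type u} (t : M.functor.obj X) :
    M.subst (SetMonad.unit R) t = t :=
  ConcreteCategory.congr_hom (M.act_unit X) t

/-- Substitution in a monad, that is, its Kleisli extension. -/
abbrev _root_.SetMonad.bind (R : SetMonad.{u}) {X Y : Type u} (f : X → R.obj Y) (t : R.obj X) :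
    R.obj Y :=
  (tautological R).subst f t

theorem subst_subst (M : MonadModule R) {X Y Z : Type u} (f : X → R.obj Y) (g : Y → R.obj Z)
    (t : M.functor.obj X) :
    M.subst g (M.subst f t) = M.subst (fun x => SetMonad.bind R g (f x)) t := by
  have h1 := ConcreteCategory.congr_hom (M.act.naturality (↾g)) (M.functor.map (↾f) t)
  have h2 := ConcreteCategory.congr_hom (M.act_act Z)
    (M.functor.map (R.map (↾g)) (M.functor.map (↾f) t))
  have h3 := ConcreteCategory.congr_hom (M.functor.map_comp (↾f) (R.map (↾g) ≫ R.μ.app Z)) t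
  have h4 := ConcreteCategory.congr_hom (M.functor.map_comp (R.map (↾g)) (R.μ.app Z))
    (M.functor.map (↾f) t)
  exact (congrArg (M.act.app Z) h1.symm).trans
    (h2.trans (congrArg (M.act.app Z) (h4.symm.trans h3.symm)))

theorem Hom.app_subst {M N : MonadModule R} (m : M ⟶ N) {X Y : Type u} (f : X → R.obj Y)
    (t : M.functor.obj X) :
    m.nat.app Y (M.subst f t) = N.subst f (m.nat.app X t) := by
  have h := ConcreteCategory.congr_hom (m.linear Y) (M.functor.map (↾f) t)
  have h' := ConcreteCategory.congr_hom (m.nat.naturality (↾f)) t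
  exact h.trans (congrArg (N.act.app Y) h')

theorem pullback_subst (f : R ⟶ S) (N : MonadModule S) {X Y : Type u} (g : X → R.obj Y)
    (t : N.functor.obj X) :
    ((pullback f).obj N).subst g t = N.subst (fun x => f.app Y (g x)) t :=
  congrArg (N.act.app Y) (ConcreteCategory.congr_hom (N.functor.map_comp (↾g) (f.app Y)) t).symm

/-- A family of functions compatible with substitution is a morphism of modules. -/
def homOfSubst {M N : MonadModule R} (φ : ∀ X : Type u, M.functor.obj X → N.functor.obj X)
    (h : ∀ {X Y : Type u} (f : X → R.obj Y) (t : M.functor.obj X),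
      φ Y (M.subst f t) = N.subst f (φ X t)) : M ⟶ N where
  nat :=
    { app := fun X => ↾φ X
      naturality := fun X Y g => by
        ext t
        change φ Y (M.functor.map g t) = N.functor.map g (φ X t)
        rw [map_eq_subst, map_eq_subst, h] }
  linear X := by
    ext t
    change φ X (M.act.app X t) = N.act.app X (φ (R.obj X) t)
    rw [act_eq_subst, act_eq_subst, h]

end MonadModule

namespace SetMonad

open MonadModule

theorem bind_unit (R : SetMonad.{u}) {X Y : Type u} (f : X → R.obj Y) (x : X) :
    R.bind f (R.unit x) = f x := by
  have h := ConcreteCategory.congr_hom (R.η.naturality (↾f)) x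
  have h' := ConcreteCategory.congr_hom (R.left_unit Y) (f x)
  exact (congrArg (R.μ.app Y) h.symm).trans h'

theorem hom_unit {R S : SetMonad.{u}} (f : R ⟶ S) {X : Type u} (x : X) :
    f.app X (R.unit x) = S.unit x :=
  ConcreteCategory.congr_hom (f.app_η X) x

/-- A monad morphism is in particular a module morphism from `R` to the pullback of `S`, so this is
linearity. -/
theorem hom_bind {R S : SetMonad.{u}} (f : R ⟶ S) {X Y : Type u} (g : X → R.obj Y)
    (t : R.obj X) : f.app Y (R.bind g t) = S.bind (fun x => f.app Y (g x)) (f.app X t) := by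
  have h := Hom.app_subst (Signature.theta.map f) g t
  exact h.trans (pullback_subst f (tautological S) g _)

theorem hom_ext {R S : SetMonad.{u}} {f g : R ⟶ S} (h : ∀ X (t : R.obj X), f.app X t = g.app X t) :
    f = g :=
  MonadHom.ext' _ _ (funext fun X => by ext t; exact h X t)

/-- The monad of a Kleisli triple. -/
def ofBind (T : Type u → Type u) (unit : ∀ {X : Type u}, X → T X)
    (bind : ∀ {X Y : Type u}, (X → T Y) → T X → T Y)
    (bind_unit : ∀ {X Y : Type u} (f : X → T Y) (x : X), bind f (unit x) = f x)
    (unit_bind : ∀ {X : Type u} (t : T X), bind unit t = t)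
    (bind_bind : ∀ {X Y Z : Type u} (f : X → T Y) (g : Y → T Z) (t : T X),
      bind g (bind f t) = bind (fun x => bind g (f x)) t) : SetMonad.{u} where
  obj := T
  map f := ↾bind fun x => unit (f x)
  map_id X := by ext t; exact unit_bind t
  map_comp f g := by
    ext t
    change bind _ t = bind _ (bind _ t)
    rw [bind_bind]
    congr 1; funext x; exact (bind_unit (fun x => unit (g x)) (f x)).symm
  η :=
    { app := fun X => ↾fun x : X => unit x
      naturality := fun X Y f => by
        ext x
        exact (bind_unit _ _).symm }
  μ :=
    { app := fun X => ↾fun t : T (T X) => bind (fun x => x) t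
      naturality := fun X Y f => by
        ext t
        change bind _ (bind _ t) = bind _ (bind _ t)
        rw [bind_bind, bind_bind]
        congr 1; funext x; exact bind_unit _ _ }
  assoc X := by
    ext t
    change bind _ (bind _ t) = bind _ (bind _ t)
    rw [bind_bind, bind_bind]
    congr 1; funext x; exact bind_unit _ _
  left_unit X := by ext t; exact bind_unit _ _
  right_unit X := by
    ext t
    change bind _ (bind _ t) = t
    rw [bind_bind]
    exact (congrArg (fun f => bind f t) (funext fun x => bind_unit _ _)).trans (unit_bind t)

/-- The substitution recovered from the functor and `μ` is a composite of two uses of `bind`, not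
`bind` itself; associativity merges them. -/
theorem bind_ofBind (T : Type u → Type u) (unit : ∀ {X : Type u}, X → T X)
    (bind : ∀ {X Y : Type u}, (X → T Y) → T X → T Y)
    (bind_unit : ∀ {X Y : Type u} (f : X → T Y) (x : X), bind f (unit x) = f x)
    (unit_bind : ∀ {X : Type u} (t : T X), bind unit t = t)
    (bind_bind : ∀ {X Y Z : Type u} (f : X → T Y) (g : Y → T Z) (t : T X),
      bind g (bind f t) = bind (fun x => bind g (f x)) t) {X Y : Type u} (f : X → T Y) (t : T X) :
    (ofBind T unit bind bind_unit unit_bind bind_bind).bind f t = bind f t :=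
  (bind_bind _ _ t).trans (congrArg (fun g => bind g t) (funext fun _ => bind_unit _ _))

/-- A family of functions compatible with units and substitution is a morphism of monads. -/
def homOfBind {R S : SetMonad.{u}} (φ : ∀ X : Type u, R.obj X → S.obj X)
    (h : ∀ {X : Type u} (x : X), φ X (R.unit x) = S.unit x)
    (h' : ∀ {X Y : Type u} (f : X → R.obj Y) (t : R.obj X),
      φ Y (R.bind f t) = S.bind (fun x => φ Y (f x)) (φ X t)) : R ⟶ S :=
  let nat : ∀ {X Y : Type u} (g : X ⟶ Y) (t : R.obj X),
      φ Y (R.map g t) = S.map g (φ X t) := fun {X Y} g t => by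
    refine (congrArg (φ Y) ((tautological R).map_eq_subst g t)).trans ((h' _ _).trans ?_)
    refine Eq.trans ?_ ((tautological S).map_eq_subst g _).symm
    simp only [h]
  { app := fun X => ↾φ X
    naturality := fun X Y g => by ext t; exact nat g t
    app_η := fun X => by ext x; exact h x
    app_μ := fun X => by
      ext t
      refine (congrArg (φ X) ((tautological R).act_eq_subst t)).trans ((h' _ _).trans ?_)
      change _ = S.μ.app X (φ (S.obj X) (R.map (↾φ X) t))
      rw [nat]
      rfl }

end SetMonad

/-! ### Elementary signatures in elementwise form -/

/-- The `m`-fold iterate of `X ↦ X + *`. -/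
def IterOption : ℕ → Type u → Type u
  | 0, X => X
  | m + 1, X => IterOption m (Option X)

namespace SetMonad

/-- The extension of a substitution under a binder. -/
def lift (R : SetMonad.{u}) {X Y : Type u} (f : X → R.obj Y) : Option X → R.obj (Option Y) :=
  fun t => t.elim (R.unit none) fun x => R.map (addPointIncl Y) (f x)

/-- The extension of a substitution under `m` binders. -/
def iterLift (R : SetMonad.{u}) : (m : ℕ) → {X Y : Type u} → (X → R.obj Y) →
    IterOption m X → R.obj (IterOption m Y)
  | 0, _, _, f => f
  | m + 1, _, _, f => R.iterLift m (R.lift f)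

end SetMonad

theorem MonadModule.deriv_subst {R : SetMonad.{u}} (M : MonadModule R) {X Y : Type u}
    (f : X → R.obj Y) (t : M.deriv.functor.obj X) :
    M.deriv.subst f t = M.subst (R.lift f) t := by
  have h : addPoint.map (↾f) ≫ addPointDist R Y = ↾(R.lift f) := by
    apply addPoint_hom_ext <;> rfl
  have h' := ConcreteCategory.congr_hom
    (M.functor.map_comp (addPoint.map (↾f)) (addPointDist R Y)) t
  rw [h] at h'
  exact congrArg (M.act.app (Option Y)) h'.symm

namespace Signature

/-- Elements of the `m`-th derivative of `R` are elements of `R` in `m` more variables. -/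
def iterDerivEquiv (R : SetMonad.{u}) : (m : ℕ) → (X : Type u) →
    ((theta.iterDeriv m).obj R).functor.obj X ≃ R.obj (IterOption m X)
  | 0, _ => Equiv.refl _
  | m + 1, X => iterDerivEquiv R m (Option X)

/-- Each derivative replaces a substitution by its lift under one binder (`deriv_subst`). The
variable sets are generalised because the recursion passes from `X` to `Option X`. -/
theorem iterDerivEquiv_subst (R : SetMonad.{u}) (m : ℕ) {X Y : Type u} (f : X → R.obj Y)
    (t : ((theta.iterDeriv m).obj R).functor.obj X) :
    iterDerivEquiv R m Y (((theta.iterDeriv m).obj R).subst f t) =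
      R.bind (R.iterLift m f) (iterDerivEquiv R m X t) := by
  induction m generalizing X Y with
  | zero => rfl
  | succ m ih =>
    exact (congrArg (iterDerivEquiv R m (Option Y)) (MonadModule.deriv_subst _ f t)).trans
      (ih (R.lift f) t)

theorem iterDerivEquiv_map {R S : SetMonad.{u}} (f : R ⟶ S) (m : ℕ) {X : Type u}
    (t : ((theta.iterDeriv m).obj R).functor.obj X) :
    iterDerivEquiv S m X (((theta.iterDeriv m).map f).nat.app X t) =
      f.app _ (iterDerivEquiv R m X t) := by
  induction m generalizing X with
  | zero => rfl
  | succ m ih => exact ih (X := Option X) t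

/-- Elements of an elementary module, as tuples of elements of the monad. -/
def elementaryEquiv (R : SetMonad.{u}) (s : List ℕ) (X : Type u) :
    ((elementary s).obj R).functor.obj X ≃
      ∀ i : Fin s.length, R.obj (IterOption (s.get i) X) :=
  Equiv.piCongrRight fun i => iterDerivEquiv R (s.get i) X

theorem elementaryEquiv_subst (R : SetMonad.{u}) (s : List ℕ) {X Y : Type u} (f : X → R.obj Y)
    (t : ((elementary s).obj R).functor.obj X) :
    elementaryEquiv R s Y (((elementary s).obj R).subst f t) =
      fun i => R.bind (R.iterLift (s.get i) f) (elementaryEquiv R s X t i) :=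
  funext fun i => iterDerivEquiv_subst R (s.get i) f (t i)

theorem elementaryEquiv_map {R S : SetMonad.{u}} (f : R ⟶ S) (s : List ℕ) {X : Type u}
    (t : ((elementary s).obj R).functor.obj X) :
    elementaryEquiv S s X (((elementary s).map f).nat.app X t) =
      fun i => f.app _ (elementaryEquiv R s X t i) :=
  funext fun i => iterDerivEquiv_map f (s.get i) (t i)

/-! ### Colimits of signatures are jointly covered by their legs -/

/-- A family of signature morphisms is jointly surjective if every element of the target lies in
the image of one of them. -/
def JointlySurjective {B : Signature.{u}} {K : Type*} {A : K → Signature.{u}}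
    (e : ∀ k, A k ⟶ B) : Prop :=
  ∀ (R : SetMonad.{u}) (X : Type u) (b : (B.obj R).functor.obj X),
    ∃ (k : K) (a : ((A k).obj R).functor.obj X), ((e k).app R).nat.app X a = b

theorem naturality_apply {A B : Signature.{u}} (m : A ⟶ B) {R S : SetMonad.{u}} (f : R ⟶ S)
    {X : Type u} (a : (A.obj R).functor.obj X) :
    (m.app S).nat.app X ((A.map f).nat.app X a) = (B.map f).nat.app X ((m.app R).nat.app X a) :=
  ConcreteCategory.congr_hom
    (NatTrans.congr_app (congrArg MonadModule.Hom.nat (m.naturality f)) X) a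

theorem map_subst (B : Signature.{u}) {R S : SetMonad.{u}} (f : R ⟶ S) {X Y : Type u}
    (g : X → R.obj Y) (b : (B.obj R).functor.obj X) :
    (B.map f).nat.app Y ((B.obj R).subst g b) =
      (B.obj S).subst (fun x => f.app Y (g x)) ((B.map f).nat.app X b) :=
  (MonadModule.Hom.app_subst (B.map f) g b).trans (MonadModule.pullback_subst f _ g _)

/-- A subset of each `B(R)(X)` that is stable under substitution and under change of monad. -/
structure Sub (B : Signature.{u}) where
  mem (R : SetMonad.{u}) (X : Type u) : Set ((B.obj R).functor.obj X)
  subst_mem {R : SetMonad.{u}} {X Y : Type u} (f : X → R.obj Y) {b : (B.obj R).functor.obj X} :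
    b ∈ mem R X → (B.obj R).subst f b ∈ mem R Y
  map_mem {R S : SetMonad.{u}} (f : R ⟶ S) {X : Type u} {b : (B.obj R).functor.obj X} :
    b ∈ mem R X → (B.map f).nat.app X b ∈ mem S X

namespace Sub

variable {B : Signature.{u}} (P : B.Sub)

/-- The module of elements of a stable subset. -/
def module (R : SetMonad.{u}) : MonadModule R where
  functor :=
    { obj := fun X => P.mem R X
      map := fun g => ↾fun t => ⟨(B.obj R).functor.map g t.1, by
        rw [MonadModule.map_eq_subst]; exact P.subst_mem _ t.2⟩
      map_id := fun X => by
        ext t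
        exact ConcreteCategory.congr_hom ((B.obj R).functor.map_id X) t.1
      map_comp := fun f g => by
        ext t
        exact ConcreteCategory.congr_hom ((B.obj R).functor.map_comp f g) t.1 }
  act :=
    { app := fun X => ↾fun t => ⟨(B.obj R).act.app X t.1, by
        rw [MonadModule.act_eq_subst]; exact P.subst_mem _ t.2⟩
      naturality := fun X Y g => by
        ext t
        exact ConcreteCategory.congr_hom ((B.obj R).act.naturality g) t.1 }
  act_act X := by
    ext t
    exact ConcreteCategory.congr_hom ((B.obj R).act_act X) t.1
  act_unit X := by
    ext t
    exact ConcreteCategory.congr_hom ((B.obj R).act_unit X) t.1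

/-- The signature of elements of a stable subset. -/
def signature : Signature.{u} where
  obj := P.module
  map f :=
    { nat :=
        { app := fun X => ↾fun t => ⟨(B.map f).nat.app X t.1, P.map_mem f t.2⟩
          naturality := fun X Y g => by
            ext t
            have h := ConcreteCategory.congr_hom ((B.map f).nat.naturality g) t.1
            exact Subtype.ext h }
      linear := fun X => by
        ext t
        have h := ConcreteCategory.congr_hom ((B.map f).linear X) t.1
        exact Subtype.ext h }
  map_id R := by
    ext X t
    have h := ConcreteCategory.congr_hom (NatTrans.congr_app (B.map_id R) X) t.1
    exact Subtype.ext h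
  map_comp f g := by
    ext X t
    have h := ConcreteCategory.congr_hom (NatTrans.congr_app (B.map_comp f g) X) t.1
    exact Subtype.ext h

/-- The inclusion of a subsignature. -/
def incl : P.signature ⟶ B where
  app _ :=
    { nat := { app := fun _ => ↾fun t => t.1, naturality := fun _ _ _ => rfl }
      linear := fun _ => rfl }
  naturality _ := rfl

/-- The corestriction of a morphism of signatures to a subsignature containing its image. -/
def lift {A : Signature.{u}} (m : A ⟶ B)
    (h : ∀ R X a, (Hom.app m R).nat.app X a ∈ P.mem R X) : A ⟶ P.signature where
  app R :=
    { nat :=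
        { app := fun X => ↾fun a => ⟨(m.app R).nat.app X a, h R X a⟩
          naturality := fun X Y g => by
            ext a
            have h := ConcreteCategory.congr_hom ((m.app R).nat.naturality g) a
            exact Subtype.ext h }
      linear := fun X => by
        ext a
        have h := ConcreteCategory.congr_hom ((m.app R).linear X) a
        exact Subtype.ext h }
  naturality f := by
    apply MonadModule.hom_ext
    ext X a
    have h' := naturality_apply m f a
    exact Subtype.ext h'

theorem lift_incl {A : Signature.{u}} (m : A ⟶ B)
    (h : ∀ R X a, (m.app R).nat.app X a ∈ P.mem R X) : P.lift m h ≫ P.incl = m :=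
  rfl

theorem hom_ext {A : Signature.{u}} {m n : A ⟶ P.signature} (h : m ≫ P.incl = n ≫ P.incl) :
    m = n := by
  ext R X a
  have h' := ConcreteCategory.congr_hom (NatTrans.congr_app
    (congrArg (fun q : A ⟶ B => (q.app R).nat) h) X) a
  exact Subtype.ext h'

/-- The joint image of a family of morphisms of signatures. -/
def image {K : Type*} {A : K → Signature.{u}} (e : ∀ k, A k ⟶ B) : B.Sub where
  mem R X := {b | ∃ (k : K) (a : ((A k).obj R).functor.obj X), ((e k).app R).nat.app X a = b}
  subst_mem := by
    rintro R X Y f _ ⟨k, a, rfl⟩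
    exact ⟨k, ((A k).obj R).subst f a, MonadModule.Hom.app_subst _ _ _⟩
  map_mem := by
    rintro R S f X _ ⟨k, a, rfl⟩
    exact ⟨k, ((A k).map f).nat.app X a, naturality_apply _ _ _⟩

end Sub

/-- The legs of a colimit cocone of signatures are jointly surjective. -/
theorem jointlySurjective_of_isColimit {J : Type*} [Category J] {F : J ⥤ Signature.{u}}
    {c : Cocone F} (hc : IsColimit c) : JointlySurjective fun j => c.ι.app j := by
  intro R X b
  -- The legs factor through their joint image `P`. The induced map from the colimit to `P`,
  -- followed by the inclusion, is the identity by uniqueness, so `b` lies in `P`.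
  let P := Sub.image fun j => c.ι.app j
  let d : Cocone F :=
    { pt := P.signature
      ι :=
        { app := fun j => P.lift (c.ι.app j) fun _ _ a => ⟨j, a, rfl⟩
          naturality := fun i j f => P.hom_ext ((c.w f).trans (Category.comp_id _).symm) } }
  have h : hc.desc d ≫ P.incl = 𝟙 c.pt := hc.hom_ext fun j => by
    rw [← Category.assoc, hc.fac, Category.comp_id]
    exact P.lift_incl _ _
  have hb := ConcreteCategory.congr_hom (NatTrans.congr_app
    (congrArg (fun q : c.pt ⟶ c.pt => (q.app R).nat) h) X) b
  obtain ⟨j, a, ha⟩ := (((hc.desc d).app R).nat.app X b).2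
  exact ⟨j, a, ha.trans hb⟩

end Signature

namespace Signature

/-! ### Definable elements of the models of a signature -/

variable {B : Signature.{u}} {K : Type u} {s : K → List ℕ} (e : ∀ k, elementary (s k) ⟶ B)

/-- The operation of a model of `B` induced by a morphism from an elementary signature to `B`. -/
def Model.op (S : B.Model) (k : K) {X : Type u}
    (a : ∀ i : Fin (s k).length, S.monad.obj (IterOption ((s k).get i) X)) : S.monad.obj X :=
  S.action.nat.app X (((e k).app S.monad).nat.app X ((elementaryEquiv S.monad (s k) X).symm a))

/-- Both `e k` and the action of the model are linear, so substitution passes to the arguments,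
lifted under the binders of each. -/
theorem Model.bind_op (S : B.Model) (k : K) {X Y : Type u} (f : X → S.monad.obj Y)
    (a : ∀ i : Fin (s k).length, S.monad.obj (IterOption ((s k).get i) X)) :
    S.monad.bind f (S.op e k a) =
      S.op e k fun i => S.monad.bind (S.monad.iterLift ((s k).get i) f) (a i) := by
  have h : ((elementary (s k)).obj S.monad).subst f ((elementaryEquiv S.monad (s k) X).symm a) =
      (elementaryEquiv S.monad (s k) Y).symm fun i =>
        S.monad.bind (S.monad.iterLift ((s k).get i) f) (a i) := by
    rw [Equiv.eq_symm_apply, elementaryEquiv_subst, Equiv.apply_symm_apply]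
  refine (MonadModule.Hom.app_subst S.action f _).symm.trans (congrArg (S.action.nat.app Y) ?_)
  exact (MonadModule.Hom.app_subst ((e k).app S.monad) f _).symm.trans
    (congrArg (((e k).app S.monad).nat.app Y) h)

/-- A family of elements of all models of `B` is definable if it is generated by the variables and
by the operations induced by the morphisms `e k`. -/
inductive Definable : (X : Type u) → (∀ S : B.Model, S.monad.obj X) → Prop
  | var {X : Type u} (x : X) : Definable X fun S => S.monad.unit x
  | op {X : Type u} (k : K)
      (z : ∀ (i : Fin (s k).length) (S : B.Model), S.monad.obj (IterOption ((s k).get i) X))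
      (h : ∀ i, Definable _ (z i)) : Definable X fun S => S.op e k fun i => z i S

end Signature

/-! ### Closure of definable families under substitution -/

/-- Functoriality of the `m`-fold iterate of `X ↦ X + *`. -/
def IterOption.map : (m : ℕ) → {X Y : Type u} → (X → Y) → IterOption m X → IterOption m Y
  | 0, _, _, f => f
  | m + 1, _, _, f => IterOption.map m (Option.map f)

namespace SetMonad

theorem lift_unit (R : SetMonad.{u}) {X Y : Type u} (g : X → Y) :
    R.lift (fun x => R.unit (g x)) = fun x => R.unit (Option.map g x) := by
  funext x
  cases x with
  | none => rfl
  | some x =>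
    exact (ConcreteCategory.congr_hom (R.η.naturality (addPointIncl Y)) (g x)).symm

theorem iterLift_unit (R : SetMonad.{u}) (m : ℕ) {X Y : Type u} (g : X → Y) :
    R.iterLift m (fun x => R.unit (g x)) = fun x => R.unit (IterOption.map m g x) := by
  induction m generalizing X Y with
  | zero => rfl
  | succ m ih => exact (congrArg (R.iterLift m) (R.lift_unit g)).trans (ih _)

end SetMonad

namespace Signature

variable {B : Signature.{u}} {K : Type u} {s : K → List ℕ} (e : ∀ k, elementary (s k) ⟶ B)

namespace Definable

variable {e}

/-- Renaming comes before general substitution: lifting a substitution under a binder weakens its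
values, which is a renaming, whereas a lifted renaming is again a renaming. -/
theorem rename {X Y : Type u} {z : ∀ S : B.Model, S.monad.obj X} (hz : Definable e X z)
    (g : X → Y) : Definable e Y fun S => S.monad.bind (fun x => S.monad.unit (g x)) (z S) := by
  induction hz generalizing Y with
  | var x =>
    simp only [SetMonad.bind_unit]
    exact var (g x)
  | op k z h ih =>
    simp only [Model.bind_op, SetMonad.iterLift_unit]
    exact op k _ fun i => ih i _

theorem lift {X Y : Type u} {f : X → ∀ S : B.Model, S.monad.obj Y}
    (hf : ∀ x, Definable e Y (f x)) (x : Option X) :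
    Definable e (Option Y) fun S => S.monad.lift (fun x => f x S) x := by
  cases x with
  | none => exact var none
  | some x =>
    have h : (fun S : B.Model => S.monad.lift (fun x => f x S) (some x)) = fun S =>
        S.monad.bind (fun y => S.monad.unit (some y)) (f x S) :=
      funext fun S => MonadModule.map_eq_subst (.tautological S.monad) (addPointIncl Y) (f x S)
    rw [h]
    exact (hf x).rename some

theorem iterLift (m : ℕ) {X Y : Type u} {f : X → ∀ S : B.Model, S.monad.obj Y}
    (hf : ∀ x, Definable e Y (f x)) (x : IterOption m X) :
    Definable e (IterOption m Y) fun S => S.monad.iterLift m (fun x => f x S) x := by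
  induction m generalizing X Y with
  | zero => exact hf x
  | succ m ih => exact ih (f := fun x S => S.monad.lift (fun x => f x S) x) (lift hf) x

theorem bind {X Y : Type u} {f : X → ∀ S : B.Model, S.monad.obj Y}
    (hf : ∀ x, Definable e Y (f x)) {z : ∀ S : B.Model, S.monad.obj X} (hz : Definable e X z) :
    Definable e Y fun S => S.monad.bind (fun x => f x S) (z S) := by
  induction hz generalizing Y with
  | var x =>
    simp only [SetMonad.bind_unit]
    exact hf x
  | op k z h ih =>
    simp only [Model.bind_op]
    exact op k _ fun i =>
      ih i (f := fun x S => S.monad.iterLift ((s k).get i) (fun x => f x S) x) (iterLift _ hf)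

end Definable

/-! ### Definable families form a small set -/

/-- The set of variables available under a list of binders. -/
def Context (X : Type u) : List ℕ → Type u
  | [] => X
  | m :: l => IterOption m (Context X l)

/-- Syntactic terms under a list of binders. -/
inductive Term (s : K → List ℕ) (X : Type u) : List ℕ → Type u
  | var {l : List ℕ} (x : Context X l) : Term s X l
  | op {l : List ℕ} (k : K) (a : ∀ i : Fin (s k).length, Term s X ((s k).get i :: l)) : Term s X l

/-- The interpretation of terms in all models. -/
def Term.eval {X : Type u} :
    {l : List ℕ} → Term s X l → ∀ S : B.Model, S.monad.obj (Context X l)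
  | _, .var x, S => S.monad.unit x
  | _, .op k a, S => S.op e k fun i => (a i).eval S

/-- Terms are indexed by lists of binders over a fixed `X`, not by arbitrary sets of variables,
which keeps them in `Type u`. The equation `h` lets the induction run over the varying set of
variables of `Definable`. -/
theorem Definable.exists_term {X Y : Type u} {z : ∀ S : B.Model, S.monad.obj Y}
    (hz : Definable e Y z) (l : List ℕ) (h : Y = Context X l) :
    ∃ t : Term s X l, ∀ S, t.eval e S = cast (congrArg S.monad.obj h) (z S) := by
  induction hz generalizing l with
  | var x =>
    subst h
    exact ⟨.var x, fun _ => rfl⟩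
  | op k z _ ih =>
    subst h
    choose t ht using fun i => ih i ((s k).get i :: l) rfl
    exact ⟨.op k t, fun S => congrArg (S.op e k) (funext fun i => ht i S)⟩

/-- Families over all models live one universe too high, but the definable ones are values of terms,
hence lie in the image of a small type. -/
instance small_definable (X : Type u) : Small.{u} {z // Definable e X z} := by
  let f : Term s X [] → ∀ S : B.Model, S.monad.obj X := fun t => t.eval e
  have : Small.{u} {z // z ∈ Set.range f} := small_range f
  refine small_of_injective (β := {z // z ∈ Set.range f}) (f := fun z => ⟨z.1, ?_⟩) ?_
  · obtain ⟨t, ht⟩ := z.2.exists_term e [] rfl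
    exact ⟨t, funext ht⟩
  · intro z w h
    exact Subtype.ext (congrArg (fun v : {z // z ∈ Set.range f} => v.1) h)

/-! ### The initial model -/

/-- The set of definable families of elements of the models of `B`. -/
def InitialObj (X : Type u) : Type u :=
  Shrink.{u} {z // Definable e X z}

namespace InitialObj

variable {e}

/-- The value of a definable family at a model. -/
noncomputable def eval {X : Type u} (S : B.Model) (t : InitialObj e X) : S.monad.obj X :=
  ((equivShrink _).symm t).1 S

/-- The element of `InitialObj e X` given by a definable family. -/
noncomputable def mk {X : Type u} (z : ∀ S : B.Model, S.monad.obj X) (h : Definable e X z) :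
    InitialObj e X :=
  equivShrink _ ⟨z, h⟩

@[simp]
theorem eval_mk {X : Type u} (z : ∀ S : B.Model, S.monad.obj X) (h : Definable e X z)
    (S : B.Model) : (mk z h).eval S = z S := by
  simp [eval, mk]

theorem definable_eval {X : Type u} (t : InitialObj e X) : Definable e X fun S => t.eval S :=
  ((equivShrink _).symm t).2

theorem ext {X : Type u} {t t' : InitialObj e X} (h : ∀ S, t.eval S = t'.eval S) : t = t' :=
  (equivShrink _).symm.injective (Subtype.ext (funext h))

/-- Variables as definable families. -/
noncomputable def unit {X : Type u} (x : X) : InitialObj e X :=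
  mk _ (.var x)

/-- Substitution of definable families. -/
noncomputable def bind {X Y : Type u} (f : X → InitialObj e Y) (t : InitialObj e X) :
    InitialObj e Y :=
  mk _ (Definable.bind (fun x => (f x).definable_eval) t.definable_eval)

@[simp]
theorem eval_unit {X : Type u} (x : X) (S : B.Model) :
    (unit x : InitialObj e X).eval S = S.monad.unit x :=
  eval_mk _ _ _

@[simp]
theorem eval_bind {X Y : Type u} (f : X → InitialObj e Y) (t : InitialObj e X) (S : B.Model) :
    (bind f t).eval S = S.monad.bind (fun x => (f x).eval S) (t.eval S) :=
  eval_mk _ _ _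

theorem bind_unit {X Y : Type u} (f : X → InitialObj e Y) (x : X) : bind f (unit x) = f x :=
  ext fun S => by simp [SetMonad.bind_unit]

theorem unit_bind {X : Type u} (t : InitialObj e X) : bind unit t = t :=
  ext fun S => by
    simp only [eval_bind, eval_unit]
    exact MonadModule.subst_unit _ _

theorem bind_bind {X Y Z : Type u} (f : X → InitialObj e Y) (g : Y → InitialObj e Z)
    (t : InitialObj e X) : bind g (bind f t) = bind (fun x => bind g (f x)) t :=
  ext fun S => by
    simp only [eval_bind]
    exact MonadModule.subst_subst _ _ _ _

end InitialObj

/-- The monad of definable families. -/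
noncomputable def initialMonad : SetMonad.{u} :=
  SetMonad.ofBind (InitialObj e) InitialObj.unit InitialObj.bind
    InitialObj.bind_unit InitialObj.unit_bind InitialObj.bind_bind

variable {e} in
theorem initialMonad_bind {X Y : Type u} (f : X → InitialObj e Y) (t : InitialObj e X) :
    (initialMonad e).bind f t = InitialObj.bind f t :=
  SetMonad.bind_ofBind (InitialObj e) InitialObj.unit InitialObj.bind
    InitialObj.bind_unit InitialObj.unit_bind InitialObj.bind_bind f t

/-- Evaluation of definable families at a model. -/
noncomputable def initialHom (S : B.Model) : initialMonad e ⟶ S.monad :=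
  SetMonad.homOfBind (fun _ t => InitialObj.eval S t) (fun x => InitialObj.eval_unit x S)
    fun f t => (congrArg (InitialObj.eval S) (initialMonad_bind f t)).trans
      (InitialObj.eval_bind f t S)

/-- Evaluations are jointly injective, so equations in the monad of definable families may be
checked in each model. -/
theorem initialMonad_ext {X : Type u} {t t' : (initialMonad e).obj X}
    (h : ∀ S, (initialHom e S).app X t = (initialHom e S).app X t') : t = t' :=
  InitialObj.ext h

/-- The right-hand side involves `k` and `a` only through the element of `B` that they represent, so
the operation is independent of the representative. The reason is naturality of `e k` along
evaluation at `S`. -/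
theorem op_initialHom (S : B.Model) (k : K) {X : Type u}
    (a : ((elementary (s k)).obj (initialMonad e)).functor.obj X) :
    S.op e k (fun i => (initialHom e S).app _ (elementaryEquiv _ (s k) X a i)) =
      S.action.nat.app X ((B.map (initialHom e S)).nat.app X
        (((e k).app (initialMonad e)).nat.app X a)) := by
  rw [← elementaryEquiv_map]
  refine congrArg (S.action.nat.app X) (Eq.trans ?_ (naturality_apply (e k) (initialHom e S) a))
  exact congrArg (((e k).app S.monad).nat.app X)
    ((elementaryEquiv S.monad (s k) X).symm_apply_apply _)

variable {e}

/-- Any lift of `b` along `e` provides `t`; by `initialMonad_ext` the result is unique, so choosing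
it costs nothing. -/
theorem exists_initialAction (he : JointlySurjective e) {X : Type u}
    (b : (B.obj (initialMonad e)).functor.obj X) :
    ∃ t : (initialMonad e).obj X, ∀ S : B.Model, (initialHom e S).app X t =
      S.action.nat.app X ((B.map (initialHom e S)).nat.app X b) := by
  obtain ⟨k, a, rfl⟩ := he _ X b
  let z (i : Fin (s k).length) : InitialObj e (IterOption ((s k).get i) X) :=
    elementaryEquiv _ (s k) X a i
  refine ⟨InitialObj.mk _ (.op k (fun i S => (z i).eval S) fun i => (z i).definable_eval),
    fun S => ?_⟩
  exact (InitialObj.eval_mk _ _ S).trans (op_initialHom e S k a)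

/-- The action of `B` on the monad of definable families. -/
noncomputable def initialAction (he : JointlySurjective e) {X : Type u}
    (b : (B.obj (initialMonad e)).functor.obj X) : (initialMonad e).obj X :=
  (exists_initialAction he b).choose

theorem initialHom_initialAction (he : JointlySurjective e) {X : Type u}
    (b : (B.obj (initialMonad e)).functor.obj X) (S : B.Model) :
    (initialHom e S).app X (initialAction he b) =
      S.action.nat.app X ((B.map (initialHom e S)).nat.app X b) :=
  (exists_initialAction he b).choose_spec S

/-- The model of definable families. -/
noncomputable def initialModel (he : JointlySurjective e) : B.Model where
  monad := initialMonad e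
  action := MonadModule.homOfSubst (fun _ b => initialAction he b) fun f b =>
    -- After evaluation at `S`, linearity reduces to that of the action of `S`.
    initialMonad_ext e fun S => by
      rw [initialHom_initialAction, map_subst]
      refine (MonadModule.Hom.app_subst S.action _ _).trans ?_
      refine Eq.trans ?_ (SetMonad.hom_bind (initialHom e S) f _).symm
      exact congrArg (S.monad.bind _) (initialHom_initialAction he b S).symm

/-! ### Initiality of the model of definable families -/

/-- Evaluation at a model, as a morphism of models. -/
noncomputable def initialModelHom (he : JointlySurjective e) (S : B.Model) :
    initialModel he ⟶ S where
  hom := initialHom e S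
  comm := by
    apply MonadModule.hom_ext
    ext X b
    exact initialHom_initialAction he b S

theorem Model.hom_action {M N : B.Model} (f : M ⟶ N) {X : Type u}
    (b : (B.obj M.monad).functor.obj X) :
    f.hom.app X (M.action.nat.app X b) = N.action.nat.app X ((B.map f.hom).nat.app X b) :=
  ConcreteCategory.congr_hom (NatTrans.congr_app (congrArg MonadModule.Hom.nat f.comm) X) b

theorem Model.hom_op (e : ∀ k, elementary (s k) ⟶ B) {M N : B.Model} (f : M ⟶ N) (k : K)
    {X : Type u} (a : ∀ i : Fin (s k).length, M.monad.obj (IterOption ((s k).get i) X)) :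
    f.hom.app X (M.op e k a) = N.op e k fun i => f.hom.app _ (a i) := by
  have h : elementaryEquiv N.monad (s k) X (((elementary (s k)).map f.hom).nat.app X
      ((elementaryEquiv M.monad (s k) X).symm a)) = fun i => f.hom.app _ (a i) := by
    rw [elementaryEquiv_map, Equiv.apply_symm_apply]
  refine (Model.hom_action f _).trans (congrArg (N.action.nat.app X) ?_)
  refine (naturality_apply (e k) f.hom _).symm.trans (congrArg (((e k).app N.monad).nat.app X) ?_)
  exact (Equiv.eq_symm_apply _).mpr h

/-- Morphisms of models preserve definable families. -/
theorem Definable.hom_eq {X : Type u} {z : ∀ S : B.Model, S.monad.obj X} (hz : Definable e X z)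
    {M N : B.Model} (f : M ⟶ N) : f.hom.app X (z M) = z N := by
  induction hz with
  | var x => exact SetMonad.hom_unit f.hom x
  | op k z h ih => rw [Model.hom_op]; simp only [ih]

/-- The initial model is one of the models over which families range. Evaluation at `S` is a
morphism of models, so it carries the value of `t` there to the value of `t` at `S`; this holds for
every `S`. -/
theorem eval_initialModel (he : JointlySurjective e) {X : Type u} (t : InitialObj e X) :
    t.eval (initialModel he) = t :=
  initialMonad_ext e fun S => t.definable_eval.hom_eq (initialModelHom he S)

/-- A signature jointly covered by a small family of elementary signatures is representable. -/
theorem isRepresentable_of_jointlySurjective (he : JointlySurjective e) : B.IsRepresentable := by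
  have h : IsInitial (initialModel he) := IsInitial.ofUniqueHom (initialModelHom he) fun S f => by
    apply Model.Hom.ext
    apply SetMonad.hom_ext
    intro X t
    -- Any `f` sends the value of `t` at the initial model, which is `t` itself, to its value at
    -- `S`; so `f` is evaluation.
    have ht := (InitialObj.definable_eval t).hom_eq f
    exact (congrArg (f.hom.app X) (eval_initialModel he t)).symm.trans ht
  exact h.hasInitial

end Signature

theorem corollary7p6 {J : Type u} [SmallCategory J] (F : J ⥤ Signature.{u})
    (hF : ∀ j : J, (F.obj j).IsAlgebraic) (c : Cocone F) (hc : IsColimit c) :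
    c.pt.IsRepresentable := by
  choose I s ι hι using hF
  -- The cover consists of all summands of all `F.obj j`; its index type is in `Type u` because `J`
  -- and each `I j` are.
  refine Signature.isRepresentable_of_jointlySurjective (K := Σ j, I j) (s := fun k => s k.1 k.2)
    (e := fun k => ι k.1 k.2 ≫ c.ι.app k.1) fun R X b => ?_
  obtain ⟨j, a, rfl⟩ := Signature.jointlySurjective_of_isColimit hc R X b
  -- A coproduct is a colimit over a discrete category, so the same lemma covers `F.obj j` by its
  -- summands.
  obtain ⟨⟨i⟩, a, rfl⟩ := Signature.jointlySurjective_of_isColimit (hι j).some R X a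
  exact ⟨⟨j, i⟩, a, rfl⟩
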